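/- Let $(\Omega,\mathcal F,\mathbb P)$ be a probability space and let $\mathcal H_1\subset L^2(\Omega)$ be a Gaussian Hilbert space, i.e. a closed linear subspace consisting of centered (possibly degenerate) Gaussian random variables, such that $\mathcal F$ is, up to $\mathbb P$-null sets, the $\sigma$-field generated by $\mathcal H_1$. Let $\mathcal H$ be a real separable Hilbert space and $W:\mathcal H\to\mathcal H_1$ a unitary operator (linear, onto, $\mathbb E[W(h)W(k)]=\langle h,k\rangle_{\mathcal H}$). For a polynomial random variable $F=p(W(h_1),\dots,W(h_m))$, with $p$ a real polynomial and $h_i\in\mathcal H$, put $DF=\sum_{i=1}^m\partial_ip(W(h_1),\dots,W(h_m))\,h_i$; the closure of this operator from $L^2(\Omega)$ to $L^2(\Omega;\mathcal H)$ is the Malliavin derivative $D:\mathbb D^{1,2}\to L^2(\Omega;\mathcal H)$. For $u=\sum_{j=1}^nF_jv_j$, with $F_j$ polynomial random variables and $v_j\in\mathcal H$, put $Du=\sum_{j=1}^nDF_j\otimes v_j$, where $h\otimes v$ is identified with the Hilbert–Schmidt operator $k\mapsto\langle h,k\rangle_{\mathcal H}v$ on $\mathcal H$; the closure of this operator from $L^2(\Omega;\mathcal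 H)$ to $L^2(\Omega;\mathcal L_2(\mathcal H))$, where $\mathcal L_2(\mathcal H)$ is the space of Hilbert–Schmidt operators on $\mathcal H$ with the Hilbert–Schmidt norm, is again denoted by $D$, and its domain by $\mathbb D^{1,2}(\mathcal H)$. The divergence $\delta=D^*$ is the adjoint of $D:\mathbb D^{1,2}\subset L^2(\Omega)\to L^2(\Omega;\mathcal H)$: its domain $\mathrm{Dom}(\delta)$ is the set of $u\in L^2(\Omega;\mathcal H)$ for which there is a constant $C$ with $|\mathbb E\langle DF,u\rangle_{\mathcal H}|\le C\|F\|_{L^2(\Omega)}$ for all $F\in\mathbb D^{1,2}$, and $\delta(u)\in L^2(\Omega)$ is then characterized by $\mathbb E[F\delta(u)]=\mathbb E\langle DF,u\rangle_{\mathcal H}$ for all $F\in\mathbb D^{1,2}$. Then $\mathbb D^{1,2}(\mathcal H)\subset\mathrm{Dom}(\delta)$. Moreover, for all $u,v\in\mathbb D^{1,2}(\mathcal H)$ and every orthonormal basis $(e_i)$ of $\mathcal H$, the series $\mathrm{Tr}(DuDv)=\sum_i\langle DuDv\,e_i,e_i\rangle_{\mathcal H}$ (where $DuDv$ is the composition of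 operators) converges almost surely, it defines an integrable random variable, and $$\mathbb E[\delta(u)\delta(v)]=\mathbb E\big[\langle u,v\rangle_{\mathcal H}\big]+\mathbb E\big[\mathrm{Tr}(DuDv)\big].$$ -/

import Mathlib

open MeasureTheory ProbabilityTheory
open scoped RealInnerProductSpace NNReal ENNReal

noncomputable section

namespace Malliavin

/-! ### Hilbert-Schmidt operators -/

section HilbertSchmidt

variable (H : Type*) [NormedAddCommGroup H] [InnerProductSpace ℝ H] [CompleteSpace H]
variable (V : Type*) [NormedAddCommGroup V] [InnerProductSpace ℝ V]

/-- The index set of a fixed orthonormal basis of `H`. -/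
def basisIndex : Set H := (exists_hilbertBasis ℝ H).choose

/-- A fixed orthonormal basis of `H`. -/
def fixedBasis : HilbertBasis (basisIndex H) ℝ H := (exists_hilbertBasis ℝ H).choose_spec.choose

/-- Bounded operators `T : H → V` with `∑ ‖T eᵢ‖² < ∞`. The condition does not depend on the
orthonormal basis that is used to write it. -/
def hilbertSchmidtSubmodule : Submodule ℝ (H →L[ℝ] V) where
  carrier := {T | Memℓp (fun i => T (fixedBasis H i)) 2}
  zero_mem' := by
    simpa using! (zero_memℓp : Memℓp (0 : basisIndex H → V) 2)
  add_mem' hS hT := by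
    simpa using! Memℓp.add hS hT
  smul_mem' c T hT := by
    simpa using! Memℓp.const_smul hT c

/-- The space `L₂(H, V)` of Hilbert-Schmidt operators from `H` to `V`. -/
def HilbertSchmidt : Type _ := hilbertSchmidtSubmodule H V

variable {H V}

namespace HilbertSchmidt

instance : AddCommGroup (HilbertSchmidt H V) :=
  inferInstanceAs (AddCommGroup (hilbertSchmidtSubmodule H V))

instance : Module ℝ (HilbertSchmidt H V) :=
  inferInstanceAs (Module ℝ (hilbertSchmidtSubmodule H V))

/-- The underlying bounded operator. -/
def toCLM : HilbertSchmidt H V →ₗ[ℝ] (H →L[ℝ] V) := (hilbertSchmidtSubmodule H V).subtype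

/-- The square summable family `(T eᵢ)ᵢ`. -/
def toLp : HilbertSchmidt H V →ₗ[ℝ] lp (fun _ : basisIndex H => V) 2 where
  toFun T := ⟨fun i => toCLM T (fixedBasis H i), T.2⟩
  map_add' _ _ := rfl
  map_smul' _ _ := rfl

theorem toLp_injective : Function.Injective (toLp : HilbertSchmidt H V → _) := by
  intro S T h
  have h1 : ∀ i, toCLM S (fixedBasis H i) = toCLM T (fixedBasis H i) := fun i =>
    congrFun (congrArg Subtype.val h) i
  apply Subtype.ext
  refine ContinuousLinearMap.ext_on (s := Set.range (fixedBasis H)) ?_ ?_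
  · exact Submodule.dense_iff_topologicalClosure_eq_top.2 (fixedBasis H).dense_span
  · rintro _ ⟨i, rfl⟩
    exact h1 i

/-- The Hilbert-Schmidt norm `‖T‖ = (∑ ‖T eᵢ‖²)^(1/2)`. -/
instance : NormedAddCommGroup (HilbertSchmidt H V) :=
  NormedAddCommGroup.induced _ _ (toLp : HilbertSchmidt H V →ₗ[ℝ] _) toLp_injective

instance : NormedSpace ℝ (HilbertSchmidt H V) :=
  NormedSpace.induced ℝ _ _ (toLp : HilbertSchmidt H V →ₗ[ℝ] _)

theorem norm_sq_eq (T : HilbertSchmidt H V) :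
    ‖T‖ ^ 2 = ∑' i, ‖toCLM T (fixedBasis H i)‖ ^ 2 := by
  have h := lp.norm_rpow_eq_tsum (p := 2) (by norm_num) (toLp T)
  simpa using! h

/-- The rank one operator `h ⊗ v`, that is `k ↦ ⟪h, k⟫ v`. -/
def tensor (h : H) (v : V) : HilbertSchmidt H V :=
  ⟨(innerSL ℝ h).smulRight v, by
    have h1 : Memℓp (fun i => (fixedBasis H).repr h i) 2 := lp.memℓp _
    change Memℓp (fun i => ⟪h, fixedBasis H i⟫ • v) 2
    refine memℓp_gen ?_
    have h2 := (memℓp_gen_iff (by norm_num)).1 h1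
    refine (h2.mul_right (‖v‖ ^ (2 : ℝ≥0∞).toReal)).congr fun i => ?_
    rw [norm_smul, Real.mul_rpow (norm_nonneg _) (norm_nonneg _), HilbertBasis.repr_apply_apply,
      real_inner_comm]⟩

theorem tensor_apply (h k : H) (v : V) : toCLM (tensor h v) k = ⟪h, k⟫ • v := rfl

end HilbertSchmidt

/-- `Tr T = ∑ ⟪T eᵢ, eᵢ⟫`, computed in the orthonormal basis `b`. -/
def traceIn {ι : Type*} (b : HilbertBasis ι ℝ H) (T : H →L[ℝ] H) : ℝ := ∑' i, ⟪T (b i), b i⟫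

end HilbertSchmidt

/-! ### Gaussian Hilbert spaces -/

variable {Ω : Type*} [MeasurableSpace Ω] {P : Measure Ω}

/-- A closed subspace of `L²(Ω)` all of whose elements are centered Gaussian (the degenerate
law, of variance `0`, included). -/
def IsGaussianHilbertSpace (H₁ : Submodule ℝ (Lp ℝ 2 P)) : Prop :=
  IsClosed (H₁ : Set (Lp ℝ 2 P)) ∧ ∀ ξ ∈ H₁, ∃ v : ℝ≥0, HasLaw (ξ : Ω → ℝ) (gaussianReal 0 v) P

/-- The sigma-field `σ(H₁)` generated by the random variables in `H₁`. -/
abbrev sigmaField (H₁ : Submodule ℝ (Lp ℝ 2 P)) : MeasurableSpace Ω :=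
  ⨆ ξ : H₁, MeasurableSpace.comap ((ξ : Lp ℝ 2 P) : Ω → ℝ) (borel ℝ)

/-- The ambient sigma-field is `σ(H₁)`, up to null sets (elements of `H₁` are random variables
up to almost sure equality). -/
def IsGeneratedBy (H₁ : Submodule ℝ (Lp ℝ 2 P)) : Prop :=
  ∀ s : Set Ω, MeasurableSet s → ∃ t : Set Ω, MeasurableSet[sigmaField H₁] t ∧ s =ᵐ[P] t

/-! ### The Malliavin derivative and the divergence -/

variable {H : Type*} [NormedAddCommGroup H] [InnerProductSpace ℝ H]
variable {H₁ : Submodule ℝ (Lp ℝ 2 P)}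

/-- `F = p(W(h₁), …, W(hₘ))` and `DF = ∑ᵢ ∂ᵢp(W(h₁), …, W(hₘ)) hᵢ` almost surely, for a
polynomial `p` and elements `h₁, …, hₘ` of `H`. -/
def IsPolynomialDeriv (W : H ≃ₗᵢ[ℝ] H₁) (F : Lp ℝ 2 P) (DF : Lp H 2 P) : Prop :=
  ∃ (m : ℕ) (h : Fin m → H) (p : MvPolynomial (Fin m) ℝ),
    (∀ᵐ ω ∂P, F ω = MvPolynomial.eval (fun j => (W (h j) : Lp ℝ 2 P) ω) p) ∧
    (∀ᵐ ω ∂P, DF ω =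
      ∑ i, MvPolynomial.eval (fun j => (W (h j) : Lp ℝ 2 P) ω) (MvPolynomial.pderiv i p) • h i)

/-- The graph of `D` on the real polynomial random variables. -/
def polynomialGraph (W : H ≃ₗᵢ[ℝ] H₁) : Submodule ℝ (Lp ℝ 2 P × Lp H 2 P) :=
  Submodule.span ℝ {x | IsPolynomialDeriv W x.1 x.2}

/-- The Malliavin derivative `D : 𝔻^{1,2} ⊂ L²(Ω) → L²(Ω; H)`: the closure of the derivative on
polynomial random variables. -/
def malliavinDeriv (W : H ≃ₗᵢ[ℝ] H₁) : Lp ℝ 2 P →ₗ.[ℝ] Lp H 2 P :=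
  (polynomialGraph W).topologicalClosure.toLinearPMap

/-- The divergence `δ = D*`, an operator from `Dom(δ) ⊂ L²(Ω; H)` to `L²(Ω)`. -/
def divergence (W : H ≃ₗᵢ[ℝ] H₁) : Lp H 2 P →ₗ.[ℝ] Lp ℝ 2 P :=
  (malliavinDeriv W).adjoint

/-- The graph of `D` on the `V`-valued polynomial random variables `∑ⱼ Fⱼ vⱼ`, on which
`D(∑ⱼ Fⱼ vⱼ) = ∑ⱼ DFⱼ ⊗ vⱼ`. -/
def polynomialGraphIn [CompleteSpace H] (V : Type*) [NormedAddCommGroup V]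
    [InnerProductSpace ℝ V] (W : H ≃ₗᵢ[ℝ] H₁) :
    Submodule ℝ (Lp V 2 P × Lp (HilbertSchmidt H V) 2 P) :=
  Submodule.span ℝ {x | ∃ (F : Lp ℝ 2 P) (DF : Lp H 2 P) (v : V), IsPolynomialDeriv W F DF ∧
    (∀ᵐ ω ∂P, x.1 ω = F ω • v) ∧ (∀ᵐ ω ∂P, x.2 ω = HilbertSchmidt.tensor (DF ω) v)}

/-- The Malliavin derivative `D : 𝔻^{1,2}(V) ⊂ L²(Ω; V) → L²(Ω; H ⊗ V)` of `V`-valued random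
variables, with `H ⊗ V` realized as the space of Hilbert-Schmidt operators from `H` to `V`. -/
def malliavinDerivIn [CompleteSpace H] (V : Type*) [NormedAddCommGroup V]
    [InnerProductSpace ℝ V] (W : H ≃ₗᵢ[ℝ] H₁) : Lp V 2 P →ₗ.[ℝ] Lp (HilbertSchmidt H V) 2 P :=
  (polynomialGraphIn V W).topologicalClosure.toLinearPMap

end Malliavin

end

/-! The formula is algebra on elementary fields `F v`, and a norm bound carries it to the closure.
Gaussian integration by parts, `E[W(h) p(W)] = E[∂ₕp(W)]`, shows that `p(W) v` has divergence `p(W)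
W(v) - ∂ᵥp(W)`. The commutation of `∂ₕ` with multiplication by `W(k)` then yields the formula for a
pair of elementary fields (`integral_skorohod_mul`), because `Tr((x ⊗ h)(y ⊗ k)) = ⟪x, k⟫ ⟪y, h⟫`.

The trace satisfies `|Tr(ST)| ≤ ‖S‖ ‖T‖` in Hilbert-Schmidt norms, so both sides of the formula are
continuous bilinear in `(u, Du, δ(u))`. On the diagonal the formula bounds `‖δ(u)‖` by a multiple of
the graph norm of `(u, Du)`. Hence divergences converge along graph-convergent sequences, and every
`u` in the domain of the closed derivative has a triple `(u, Du, ξ)` in the closure of the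
elementary triples. Duality with `D` passes to that closure, which identifies `ξ` with `δ(u)`; the
formula passes to it as well.

The closures must be graphs, and `D` must be densely defined for its adjoint to be determined. Both
follow from the totality of polynomials in `L²(Ω)` (`eq_zero_of_integral_mul_polyRV_eq_zero`), which
is where the generation of the sigma-field enters: for `X` orthogonal to all polynomials, the
measures `X⁺P` and `X⁻P` give each `W(k)` the same moments, hence the same law, and so they
coincide. -/

namespace Malliavin

/-! ### Hilbert-Schmidt operators and the trace form -/

section TraceClass

variable {H : Type*} [NormedAddCommGroup H] [InnerProductSpace ℝ H] [CompleteSpace H]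
variable {ι κ : Type*}

theorem enorm_sq_eq_tsum_inner {E : Type*} [NormedAddCommGroup E] [InnerProductSpace ℝ E]
    (c : HilbertBasis κ ℝ E) (x : E) :
    ‖x‖ₑ ^ 2 = ∑' j, ‖⟪x, c j⟫‖ₑ ^ 2 := by
  have h := c.hasSum_inner_mul_inner x x
  have h2 : ∀ j, ⟪x, c j⟫ * ⟪c j, x⟫ = ‖⟪x, c j⟫‖ ^ 2 := fun j => by
    rw [real_inner_comm x (c j), Real.norm_eq_abs, sq_abs, sq]
  simp_rw [h2] at h
  rw [real_inner_self_eq_norm_sq] at h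
  have h3 := ENNReal.ofReal_tsum_of_nonneg (fun j => sq_nonneg ‖⟪x, c j⟫‖) h.summable
  rw [h.tsum_eq] at h3
  simp_rw [ENNReal.ofReal_pow (norm_nonneg _), ofReal_norm] at h3
  exact h3

/-- By Parseval both sides are the double sum of `⟪T bᵢ, cⱼ⟫²`, and in `ℝ≥0∞` the order of summation
is free. The two bases being unrelated, this gives the basis independence of the Hilbert-Schmidt
norm. -/
theorem tsum_enorm_sq_adjoint (b : HilbertBasis ι ℝ H) (c : HilbertBasis κ ℝ H) (T : H →L[ℝ] H) :
    ∑' i, ‖T (b i)‖ₑ ^ 2 = ∑' j, ‖ContinuousLinearMap.adjoint T (c j)‖ₑ ^ 2 := by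
  simp_rw [enorm_sq_eq_tsum_inner c (T _),
    enorm_sq_eq_tsum_inner b (ContinuousLinearMap.adjoint T _)]
  rw [ENNReal.tsum_comm]
  refine tsum_congr fun j => tsum_congr fun i => ?_
  rw [ContinuousLinearMap.adjoint_inner_left, real_inner_comm]

theorem hasSum_norm_sq_of_tsum_enorm_sq {E : Type*} [NormedAddCommGroup E] {f : ι → E} {r : ℝ}
    (hr : 0 ≤ r) (h : ∑' i, ‖f i‖ₑ ^ 2 = ENNReal.ofReal r) : HasSum (fun i => ‖f i‖ ^ 2) r := by
  have h1 : ∀ i, ENNReal.ofReal (‖f i‖ ^ 2) = ‖f i‖ₑ ^ 2 := fun i => by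
    rw [ENNReal.ofReal_pow (norm_nonneg _), ofReal_norm]
  have hs : Summable fun i => ‖f i‖ ^ 2 := by
    have h2 := ENNReal.summable_toReal (f := fun i => ‖f i‖ₑ ^ 2)
      (by rw [h]; exact ENNReal.ofReal_ne_top)
    refine h2.congr fun i => ?_
    rw [← h1, ENNReal.toReal_ofReal (sq_nonneg _)]
  have h3 := ENNReal.ofReal_tsum_of_nonneg (fun i => sq_nonneg ‖f i‖) hs
  simp_rw [h1, h] at h3
  rw [ENNReal.ofReal_eq_ofReal_iff (tsum_nonneg fun i => sq_nonneg _) hr] at h3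
  exact h3 ▸ hs.hasSum

namespace HilbertSchmidt

theorem tsum_enorm_sq_fixedBasis (T : HilbertSchmidt H H) :
    ∑' i, ‖toCLM T (fixedBasis H i)‖ₑ ^ 2 = ENNReal.ofReal (‖T‖ ^ 2) := by
  have h1 : Summable fun i => ‖toCLM T (fixedBasis H i)‖ ^ 2 := by
    have := (memℓp_gen_iff (p := 2) (by norm_num)).1 T.2
    simpa using! this
  rw [norm_sq_eq, ENNReal.ofReal_tsum_of_nonneg (fun i => sq_nonneg _) h1]
  simp_rw [ENNReal.ofReal_pow (norm_nonneg _), ofReal_norm]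

theorem hasSum_norm_adjoint_sq (b : HilbertBasis ι ℝ H) (T : HilbertSchmidt H H) :
    HasSum (fun i => ‖ContinuousLinearMap.adjoint (toCLM T) (b i)‖ ^ 2) (‖T‖ ^ 2) :=
  hasSum_norm_sq_of_tsum_enorm_sq (sq_nonneg _) <| by
    rw [← tsum_enorm_sq_adjoint (fixedBasis H) b, tsum_enorm_sq_fixedBasis]

theorem hasSum_norm_sq (b : HilbertBasis ι ℝ H) (T : HilbertSchmidt H H) :
    HasSum (fun i => ‖toCLM T (b i)‖ ^ 2) (‖T‖ ^ 2) :=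
  hasSum_norm_sq_of_tsum_enorm_sq (sq_nonneg _) <| by
    -- Passing to the adjoint twice returns to `T` while replacing `b` by the fixed basis.
    rw [tsum_enorm_sq_adjoint b b, tsum_enorm_sq_adjoint b (fixedBasis H),
      ContinuousLinearMap.adjoint_adjoint, tsum_enorm_sq_fixedBasis]

/-- Since `⟪S T bᵢ, bᵢ⟫ = ⟪T bᵢ, S* bᵢ⟫`, Cauchy-Schwarz applies first in `H` and then in `ℓ²`. -/
theorem summable_norm_inner_comp_and_le (b : HilbertBasis ι ℝ H) (S T : HilbertSchmidt H H) :
    (Summable fun i => ‖⟪(toCLM S ∘L toCLM T) (b i), b i⟫‖) ∧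
      ∑' i, ‖⟪(toCLM S ∘L toCLM T) (b i), b i⟫‖ ≤ ‖S‖ * ‖T‖ := by
  have hle : ∀ i, ‖⟪(toCLM S ∘L toCLM T) (b i), b i⟫‖ ≤
      ‖ContinuousLinearMap.adjoint (toCLM S) (b i)‖ * ‖toCLM T (b i)‖ := fun i => by
    rw [ContinuousLinearMap.comp_apply, ← ContinuousLinearMap.adjoint_inner_right, mul_comm]
    exact norm_inner_le_norm _ _
  have hS := hasSum_norm_adjoint_sq b S
  have hT := hasSum_norm_sq b T
  have key := Real.inner_le_Lp_mul_Lq_tsum_of_nonneg (p := 2) (q := 2) Real.HolderConjugate.two_two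
    (f := fun i => ‖ContinuousLinearMap.adjoint (toCLM S) (b i)‖) (g := fun i => ‖toCLM T (b i)‖)
    (fun i => norm_nonneg _) (fun i => norm_nonneg _)
    (by simpa using hS.summable) (by simpa using hT.summable)
  have hsum : Summable fun i =>
      ‖ContinuousLinearMap.adjoint (toCLM S) (b i)‖ * ‖toCLM T (b i)‖ :=
    Real.summable_mul_of_Lp_Lq_of_nonneg (p := 2) (q := 2) Real.HolderConjugate.two_two
      (fun i => norm_nonneg _) (fun i => norm_nonneg _)
      (by simpa using hS.summable) (by simpa using hT.summable)
  refine ⟨Summable.of_nonneg_of_le (fun _ => norm_nonneg _) hle hsum, ?_⟩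
  refine (Summable.tsum_le_tsum hle (Summable.of_nonneg_of_le (fun _ => norm_nonneg _) hle hsum)
    hsum).trans (key.trans_eq ?_)
  simp only [Real.rpow_two]
  rw [hS.tsum_eq, hT.tsum_eq, ← Real.sqrt_eq_rpow, ← Real.sqrt_eq_rpow,
    Real.sqrt_sq (norm_nonneg _), Real.sqrt_sq (norm_nonneg _)]

theorem summable_inner_comp (b : HilbertBasis ι ℝ H) (S T : HilbertSchmidt H H) :
    Summable fun i => ⟪(toCLM S ∘L toCLM T) (b i), b i⟫ :=
  (summable_norm_inner_comp_and_le b S T).1.of_norm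

theorem abs_traceIn_comp_le (b : HilbertBasis ι ℝ H) (S T : HilbertSchmidt H H) :
    |traceIn b (toCLM S ∘L toCLM T)| ≤ ‖S‖ * ‖T‖ := by
  obtain ⟨h1, h2⟩ := summable_norm_inner_comp_and_le b S T
  exact (norm_tsum_le_tsum_norm h1).trans h2

/-- The bilinear form `(S, T) ↦ Tr (S T)` on Hilbert-Schmidt operators. -/
noncomputable def traceComp (b : HilbertBasis ι ℝ H) :
    HilbertSchmidt H H →L[ℝ] HilbertSchmidt H H →L[ℝ] ℝ :=
  LinearMap.mkContinuous₂ (LinearMap.mk₂ ℝ (fun S T => traceIn b (toCLM S ∘L toCLM T))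
    (fun S S' T => by
      simp only [traceIn]
      rw [← (summable_inner_comp b S T).tsum_add (summable_inner_comp b S' T)]
      simp [inner_add_left])
    (fun c S T => by
      simp only [traceIn, smul_eq_mul]
      rw [← tsum_mul_left]
      simp [inner_smul_left])
    (fun S T T' => by
      simp only [traceIn]
      rw [← (summable_inner_comp b S T).tsum_add (summable_inner_comp b S T')]
      simp [inner_add_left])
    (fun c S T => by
      simp only [traceIn, smul_eq_mul]
      rw [← tsum_mul_left]
      simp [inner_smul_left])) 1 fun S T => by
    rw [one_mul]
    exact abs_traceIn_comp_le b S T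

theorem traceComp_apply (b : HilbertBasis ι ℝ H) (S T : HilbertSchmidt H H) :
    traceComp b S T = traceIn b (toCLM S ∘L toCLM T) := rfl

/-- Matrix entries of `T` become values of the continuous trace form, which lets them serve as test
functionals on the Hilbert-Schmidt space. -/
theorem traceComp_tensor_right (b : HilbertBasis ι ℝ H) (T : HilbertSchmidt H H) (h k : H) :
    traceComp b T (tensor k h) = ⟪toCLM T h, k⟫ := by
  rw [traceComp_apply, traceIn, real_inner_comm, ← (b.hasSum_inner_mul_inner _ _).tsum_eq]
  refine tsum_congr fun i => ?_
  rw [ContinuousLinearMap.comp_apply, tensor_apply, map_smul, real_inner_smul_left,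
    real_inner_comm (toCLM T h)]

theorem traceComp_tensor (b : HilbertBasis ι ℝ H) (x y h k : H) :
    traceComp b (tensor x h) (tensor y k) = ⟪x, k⟫ * ⟪y, h⟫ := by
  rw [traceComp_tensor_right, tensor_apply, real_inner_smul_left, real_inner_comm,
    real_inner_comm y]

end HilbertSchmidt

end TraceClass

/-! ### Polarization and directional derivatives of polynomials -/

section Polynomial

/-- Polarization: `x ^ n * y` is, up to the factor `n + 1`, the coefficient of `t` in `(t y + x) ^
(n + 1)`. A linear functional that kills all powers kills this polynomial in `t`, hence each of its
coefficients. -/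
theorem pow_mul_mem_span_pow {A : Type*} [CommRing A] [Algebra ℝ A] (V : Submodule ℝ A) {x y : A}
    (hx : x ∈ V) (hy : y ∈ V) (n : ℕ) :
    x ^ n * y ∈ Submodule.span ℝ {q : A | ∃ l ∈ V, ∃ n : ℕ, q = l ^ n} := by
  by_contra hmem
  obtain ⟨f, hf, hker⟩ := Submodule.exists_le_ker_of_notMem hmem
  have h0 : ∀ t : ℝ, f ((t • y + x) ^ (n + 1)) = 0 := fun t =>
    hker (Submodule.subset_span ⟨_, V.add_mem (V.smul_mem t hy) hx, n + 1, rfl⟩)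
  let p : Polynomial ℝ := ∑ m ∈ Finset.range (n + 1 + 1),
    Polynomial.monomial m (f (y ^ m * x ^ (n + 1 - m)) * ((n + 1).choose m : ℝ))
  have hp : p = 0 := by
    refine Polynomial.funext fun t => ?_
    rw [Polynomial.eval_zero, ← h0 t, add_pow, map_sum, Polynomial.eval_finsetSum]
    refine Finset.sum_congr rfl fun m _ => ?_
    have hc : ∀ (z : A) (N : ℕ), f (z * N) = f z * N := fun z N => by
      rw [mul_comm, ← nsmul_eq_mul, map_nsmul, nsmul_eq_mul, mul_comm]
    rw [Polynomial.eval_monomial, smul_pow, hc, smul_mul_assoc, map_smul, smul_eq_mul]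
    ring
  have h1 : p.coeff 1 = f (y * x ^ n) * (n + 1) := by
    simp [p, Polynomial.finsetSum_coeff, Polynomial.coeff_monomial]
  rw [hp, Polynomial.coeff_zero, eq_comm, mul_eq_zero, mul_comm y] at h1
  exact h1.elim hf (by positivity)

theorem span_pow_linear_eq_top (σ : Type*) :
    Submodule.span ℝ {q : MvPolynomial σ ℝ |
      ∃ l ∈ Submodule.span ℝ (Set.range MvPolynomial.X), ∃ n : ℕ, q = l ^ n} = ⊤ := by
  refine Submodule.eq_top_iff'.2 fun p => ?_
  induction p using MvPolynomial.induction_on with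
  | C a =>
    rw [MvPolynomial.C_eq_smul_one]
    exact Submodule.smul_mem _ _ (Submodule.subset_span ⟨0, Submodule.zero_mem _, 0, by simp⟩)
  | add p q hp hq => exact Submodule.add_mem _ hp hq
  | mul_X p i hp =>
    induction hp using Submodule.span_induction with
    | mem x hx =>
      obtain ⟨l, hl, n, rfl⟩ := hx
      exact pow_mul_mem_span_pow _ hl (Submodule.subset_span ⟨i, rfl⟩) n
    | zero => simp
    | add x y _ _ hx hy => rw [add_mul]; exact Submodule.add_mem _ hx hy
    | smul a x _ hx => rw [smul_mul_assoc]; exact Submodule.smul_mem _ _ hx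

variable {H : Type*} [NormedAddCommGroup H] [InnerProductSpace ℝ H]

/-- The directional derivative `∂ₕ` on polynomials in the symbols `X k`, `k : H`, with
`∂ₕ (X k) = ⟪h, k⟫`. -/
noncomputable def dirDeriv (h : H) : Derivation ℝ (MvPolynomial H ℝ) (MvPolynomial H ℝ) :=
  MvPolynomial.mkDerivation ℝ fun k => MvPolynomial.C ⟪h, k⟫

@[simp]
theorem dirDeriv_X (h k : H) : dirDeriv h (MvPolynomial.X k) = MvPolynomial.C ⟪h, k⟫ :=
  MvPolynomial.mkDerivation_X _ _ _

@[simp]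
theorem dirDeriv_C (h : H) (a : ℝ) : dirDeriv h (MvPolynomial.C a) = 0 :=
  (dirDeriv h).map_algebraMap a

theorem dirDeriv_mul (h : H) (p q : MvPolynomial H ℝ) :
    dirDeriv h (p * q) = p * dirDeriv h q + q * dirDeriv h p := by
  rw [Derivation.leibniz, smul_eq_mul, smul_eq_mul]

theorem dirDeriv_comm (h k : H) (p : MvPolynomial H ℝ) :
    dirDeriv h (dirDeriv k p) = dirDeriv k (dirDeriv h p) := by
  induction p using MvPolynomial.induction_on with
  | C a => simp
  | add p q hp hq => simp [hp, hq]
  | mul_X p i hp =>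
    simp only [dirDeriv_mul, map_add, dirDeriv_X, dirDeriv_C, hp]
    ring

/-- The chain rule linking partial derivatives in finitely many variables, as in the definition of
`D`, with the derivation on symbols indexed by all of `H`. -/
theorem dirDeriv_rename (k : H) {m : ℕ} (h : Fin m → H) (p : MvPolynomial (Fin m) ℝ) :
    dirDeriv k (MvPolynomial.rename h p) =
      ∑ i, MvPolynomial.C ⟪k, h i⟫ * MvPolynomial.rename h (MvPolynomial.pderiv i p) := by
  induction p using MvPolynomial.induction_on with
  | C a => simp
  | add p q hp hq => simp [hp, hq, mul_add, Finset.sum_add_distrib]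
  | mul_X p i hp =>
    simp only [map_mul, MvPolynomial.rename_X, dirDeriv_X, hp, Derivation.leibniz,
      smul_eq_mul, map_add, mul_add, Finset.sum_add_distrib, MvPolynomial.pderiv_X,
      Finset.mul_sum]
    congr 1
    · rw [Finset.sum_eq_single i]
      · simp [mul_comm]
      · intro j _ hj
        simp [Pi.single_eq_of_ne' hj]
      · simp
    · exact Finset.sum_congr rfl fun j _ => by ring

end Polynomial

/-! ### Moments of a centered real Gaussian -/

section Moments

theorem hasDerivAt_integral_pow_mul_exp_gaussianReal (v : ℝ≥0) (n : ℕ) (t : ℝ) :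
    HasDerivAt (fun t => ∫ x, x ^ n * Real.exp (t * x) ∂(gaussianReal 0 v))
      (∫ x, x ^ (n + 1) * Real.exp (t * x) ∂(gaussianReal 0 v)) t :=
  hasDerivAt_integral_pow_mul_exp_real (X := fun x => x) (by simp) n

/-- The tilt `exp (t x)` makes an induction possible: differentiating the identity for `n` in `t`
gives the one for `n + 1`. The base case is the derivative of the moment generating function, and
only `t = 0` is needed afterwards. -/
theorem integral_pow_mul_exp_gaussianReal (v : ℝ≥0) (n : ℕ) (t : ℝ) :
    ∫ x, x ^ (n + 1) * Real.exp (t * x) ∂(gaussianReal 0 v) =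
      v * t * ∫ x, x ^ n * Real.exp (t * x) ∂(gaussianReal 0 v) +
      v * n * ∫ x, x ^ (n - 1) * Real.exp (t * x) ∂(gaussianReal 0 v) := by
  induction n generalizing t with
  | zero =>
    have h1 := hasDerivAt_integral_pow_mul_exp_gaussianReal v 0 t
    have h2 : (fun t => ∫ x, x ^ 0 * Real.exp (t * x) ∂(gaussianReal 0 v)) =
        fun t => Real.exp (v * t ^ 2 / 2) := by
      funext s
      have := congrFun (mgf_fun_id_gaussianReal (μ := 0) (v := v)) s
      simpa [mgf] using this
    have h3 : HasDerivAt (fun t : ℝ => Real.exp (v * t ^ 2 / 2))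
        (Real.exp (v * t ^ 2 / 2) * (v * (2 * t) / 2)) t := by
      have := ((((hasDerivAt_id t).pow 2).const_mul (v : ℝ)).div_const 2).exp
      simpa using this
    rw [h2] at h1
    rw [h1.unique h3, congrFun h2 t]
    simp
    ring
  | succ n ih =>
    have h1 := hasDerivAt_integral_pow_mul_exp_gaussianReal v (n + 1) t
    rw [funext ih] at h1
    have h2 := (((hasDerivAt_id t).const_mul (v : ℝ)).mul
      (hasDerivAt_integral_pow_mul_exp_gaussianReal v n t)).add
      ((hasDerivAt_integral_pow_mul_exp_gaussianReal v (n - 1) t).const_mul ((v : ℝ) * n))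
    rw [h1.unique h2]
    -- For `n = 0` the truncated `n - 1` is harmless, because its term carries the factor `n`.
    rcases n with _ | n
    · simp
      ring
    · simp
      ring

theorem integral_pow_succ_gaussianReal (v : ℝ≥0) (n : ℕ) :
    ∫ x, x ^ (n + 1) ∂(gaussianReal 0 v) = v * n * ∫ x, x ^ (n - 1) ∂(gaussianReal 0 v) := by
  simpa using integral_pow_mul_exp_gaussianReal v n 0

end Moments

/-! ### Gaussian integration by parts and the isometry for elementary fields -/

section GaussianHilbert

variable {Ω : Type*} [MeasurableSpace Ω] {P : Measure Ω}
variable {H₁ : Submodule ℝ (Lp ℝ 2 P)}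
variable {H : Type*} [NormedAddCommGroup H] [InnerProductSpace ℝ H]
variable (W : H ≃ₗᵢ[ℝ] H₁)

/-- The random variable `p(W)` for a polynomial `p` in the symbols `X h`, `h : H`. -/
noncomputable def polyRV (p : MvPolynomial H ℝ) (ω : Ω) : ℝ :=
  MvPolynomial.eval (fun h => (W h : Lp ℝ 2 P) ω) p

@[simp] theorem polyRV_C (a : ℝ) (ω : Ω) : polyRV W (MvPolynomial.C a) ω = a := by simp [polyRV]

@[simp] theorem polyRV_zero (ω : Ω) : polyRV W 0 ω = 0 := by simp [polyRV]

@[simp] theorem polyRV_X (h : H) (ω : Ω) :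
    polyRV W (MvPolynomial.X h) ω = (W h : Lp ℝ 2 P) ω := by simp [polyRV]

@[simp] theorem polyRV_add (p q : MvPolynomial H ℝ) (ω : Ω) :
    polyRV W (p + q) ω = polyRV W p ω + polyRV W q ω := by simp [polyRV]

@[simp] theorem polyRV_sub (p q : MvPolynomial H ℝ) (ω : Ω) :
    polyRV W (p - q) ω = polyRV W p ω - polyRV W q ω := by simp [polyRV]

@[simp] theorem polyRV_smul (a : ℝ) (p : MvPolynomial H ℝ) (ω : Ω) :
    polyRV W (a • p) ω = a * polyRV W p ω := by simp [polyRV]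

@[simp] theorem polyRV_mul (p q : MvPolynomial H ℝ) (ω : Ω) :
    polyRV W (p * q) ω = polyRV W p ω * polyRV W q ω := by simp [polyRV]

@[simp] theorem polyRV_pow (p : MvPolynomial H ℝ) (n : ℕ) (ω : Ω) :
    polyRV W (p ^ n) ω = polyRV W p ω ^ n := by simp [polyRV]

theorem polyRV_rename {m : ℕ} (h : Fin m → H) (p : MvPolynomial (Fin m) ℝ) (ω : Ω) :
    polyRV W (MvPolynomial.rename h p) ω =
      MvPolynomial.eval (fun j => (W (h j) : Lp ℝ 2 P) ω) p := by
  rw [polyRV, MvPolynomial.eval_rename]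
  rfl

theorem coeFn_map_smul_add (a : ℝ) (h k : H) : ∀ᵐ ω ∂P,
    (W (a • h + k) : Lp ℝ 2 P) ω = a * (W h : Lp ℝ 2 P) ω + (W k : Lp ℝ 2 P) ω := by
  have h1 : (W (a • h + k) : Lp ℝ 2 P) = a • (W h : Lp ℝ 2 P) + (W k : Lp ℝ 2 P) := by simp
  rw [h1]
  filter_upwards [Lp.coeFn_add (a • (W h : Lp ℝ 2 P)) (W k : Lp ℝ 2 P),
    Lp.coeFn_smul a (W h : Lp ℝ 2 P)] with ω h2 h3
  rw [h2, Pi.add_apply, h3, Pi.smul_apply, smul_eq_mul]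

theorem coeFn_map_zero : ∀ᵐ ω ∂P, (W 0 : Lp ℝ 2 P) ω = 0 := by
  have h1 : (W 0 : Lp ℝ 2 P) = 0 := by simp
  rw [h1]
  filter_upwards [Lp.coeFn_zero ℝ 2 P] with ω h2
  rw [h2, Pi.zero_apply]

theorem coeFn_map_sum {ι : Type*} (s : Finset ι) (c : ι → ℝ) (h : ι → H) : ∀ᵐ ω ∂P,
    (W (∑ i ∈ s, c i • h i) : Lp ℝ 2 P) ω = ∑ i ∈ s, c i * (W (h i) : Lp ℝ 2 P) ω := by
  classical
  induction s using Finset.induction_on with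
  | empty => simpa using coeFn_map_zero W
  | insert i s hi ih =>
    filter_upwards [ih, coeFn_map_smul_add W (c i) (h i) (∑ i ∈ s, c i • h i)] with ω h1 h2
    rw [Finset.sum_insert hi, Finset.sum_insert hi, h2, h1]

/-- The symbols `X h` are formally independent, while `W` is linear only almost surely. A linear
form in the symbols can still be replaced by a single `W k`, both in value and in its derivatives.
-/
theorem exists_dirDeriv_eq_of_mem_span {l : MvPolynomial H ℝ}
    (hl : l ∈ Submodule.span ℝ (Set.range MvPolynomial.X)) :
    ∃ k : H, (∀ h, dirDeriv h l = MvPolynomial.C ⟪h, k⟫) ∧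
      ∀ᵐ ω ∂P, polyRV W l ω = (W k : Lp ℝ 2 P) ω := by
  induction hl using Submodule.span_induction with
  | mem x hx =>
    obtain ⟨k, rfl⟩ := hx
    exact ⟨k, by simp, by simp⟩
  | zero =>
    refine ⟨0, by simp, ?_⟩
    filter_upwards [coeFn_map_zero W] with ω h
    rw [h, polyRV_zero]
  | add x y _ _ hx hy =>
    obtain ⟨k, hk, hk'⟩ := hx
    obtain ⟨l, hl, hl'⟩ := hy
    refine ⟨(1 : ℝ) • k + l, fun h => by simp [hk, hl, inner_add_right], ?_⟩
    filter_upwards [hk', hl', coeFn_map_smul_add W 1 k l] with ω h1 h2 h3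
    rw [h3, polyRV_add, h1, h2, one_mul]
  | smul a x _ hx =>
    obtain ⟨k, hk, hk'⟩ := hx
    refine ⟨a • k + 0, fun h => by simp [hk, inner_smul_right, MvPolynomial.smul_eq_C_mul], ?_⟩
    filter_upwards [hk', coeFn_map_zero W, coeFn_map_smul_add W a k 0] with ω h1 h2 h3
    rw [h3, polyRV_smul, h1, h2, add_zero]

variable (hG : IsGaussianHilbertSpace H₁)
include hG

theorem IsGaussianHilbertSpace.hasLaw (h : H) :
    ∃ v : ℝ≥0, HasLaw ((W h : Lp ℝ 2 P) : Ω → ℝ) (gaussianReal 0 v) P :=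
  hG.2 _ (W h).2

theorem IsGaussianHilbertSpace.memLp (h : H) {q : ℝ≥0∞} (hq : q ≠ ∞) :
    MemLp ((W h : Lp ℝ 2 P) : Ω → ℝ) q P := by
  obtain ⟨v, hv⟩ := hG.hasLaw W h
  have := memLp_id_gaussianReal' (μ := 0) (v := v) q hq
  rw [← hv.map_eq] at this
  exact (memLp_map_measure_iff aestronglyMeasurable_id hv.aemeasurable).1 this

theorem IsGaussianHilbertSpace.integrable_exp_mul (h : H) (t : ℝ) :
    Integrable (fun ω => Real.exp (t * (W h : Lp ℝ 2 P) ω)) P := by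
  obtain ⟨v, hv⟩ := hG.hasLaw W h
  have := integrable_exp_mul_gaussianReal (μ := 0) (v := v) t
  rw [← hv.map_eq] at this
  exact (integrable_map_measure (by fun_prop) hv.aemeasurable).1 this

theorem IsGaussianHilbertSpace.integral_eq_zero (h : H) : ∫ ω, (W h : Lp ℝ 2 P) ω ∂P = 0 := by
  obtain ⟨v, hv⟩ := hG.hasLaw W h
  rw [hv.integral_eq]
  simp

theorem IsGaussianHilbertSpace.integral_pow_succ (h : H) (n : ℕ) :
    ∫ ω, (W h : Lp ℝ 2 P) ω ^ (n + 1) ∂P =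
      n * ⟪h, h⟫ * ∫ ω, (W h : Lp ℝ 2 P) ω ^ (n - 1) ∂P := by
  obtain ⟨v, hv⟩ := hG.hasLaw W h
  have hint : ∀ n : ℕ, ∫ ω, (W h : Lp ℝ 2 P) ω ^ n ∂P = ∫ x, x ^ n ∂(gaussianReal 0 v) :=
      fun n => by
    rw [← hv.map_eq, integral_map hv.aemeasurable (by fun_prop)]
  -- The variance is the second moment, which the isometry `W` identifies with `⟪h, h⟫`.
  have h2 : (v : ℝ) = ⟪h, h⟫ := by
    have h3 := integral_pow_succ_gaussianReal v 1
    rw [← hint 2] at h3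
    have h4 : ⟪h, h⟫ = ∫ ω, (W h : Lp ℝ 2 P) ω ^ 2 ∂P := by
      rw [← W.inner_map_map, Submodule.coe_inner, L2.inner_def]
      simp [sq]
    rw [h4, h3]
    simp
  rw [hint, hint, integral_pow_succ_gaussianReal, h2]
  ring

variable [IsProbabilityMeasure P]

theorem IsGaussianHilbertSpace.memLp_polyRV (p : MvPolynomial H ℝ) {q : ℝ≥0∞} (hq : q ≠ ∞) :
    MemLp (polyRV W p) q P := by
  induction p using MvPolynomial.induction_on generalizing q with
  | C a => simpa [Function.comp_def, funext (polyRV_C W a)] using! memLp_const a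
  | add p r hp hr =>
    rw [funext (polyRV_add W p r)]
    exact (hp hq).add (hr hq)
  | mul_X p h hp =>
    -- Each multiplication by a variable costs a doubling of the exponent, so the induction runs
    -- over all finite `q`.
    have : ENNReal.HolderTriple (2 * q) (2 * q) q := ⟨by
      rw [ENNReal.mul_inv (by simp) (by simp), ← add_mul, ENNReal.inv_two_add_inv_two, one_mul]⟩
    have h2q : 2 * q ≠ ∞ := ENNReal.mul_ne_top (by simp) hq
    rw [funext (polyRV_mul W p _)]
    simp_rw [polyRV_X]
    exact (hG.memLp W h h2q).mul' (hp h2q)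

theorem IsGaussianHilbertSpace.integrable_polyRV (p : MvPolynomial H ℝ) :
    Integrable (polyRV W p) P :=
  memLp_one_iff_integrable.1 (hG.memLp_polyRV W p (by simp))

/-- Every linear combination of `W h` and `W k` is again a value of `W`, so the pair is jointly
Gaussian and vanishing covariance suffices. -/
theorem IsGaussianHilbertSpace.indepFun {h k : H} (hk : ⟪h, k⟫ = 0) :
    IndepFun ((W h : Lp ℝ 2 P) : Ω → ℝ) ((W k : Lp ℝ 2 P) : Ω → ℝ) P := by
  have hm : ∀ h : H, AEMeasurable ((W h : Lp ℝ 2 P) : Ω → ℝ) P :=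
    fun h => (Lp.stronglyMeasurable _).measurable.aemeasurable
  refine HasGaussianLaw.indepFun_of_covariance_eq_zero ⟨?_⟩ ?_
  · refine isGaussian_of_map_eq_gaussianReal fun L => ?_
    obtain ⟨v, hv⟩ := hG.hasLaw W (L (1, 0) • h + (L (0, 1) • k + 0))
    refine ⟨0, v, ?_⟩
    rw [← hv.map_eq, AEMeasurable.map_map_of_aemeasurable (by fun_prop) ((hm h).prodMk (hm k))]
    refine Measure.map_congr ?_
    filter_upwards [coeFn_map_smul_add W (L (1, 0)) h (L (0, 1) • k + 0),
      coeFn_map_smul_add W (L (0, 1)) k 0, coeFn_map_zero W] with ω h1 h2 h3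
    rw [h1, h2, h3, add_zero, Function.comp_apply, mul_comm, mul_comm (L _), ← smul_eq_mul,
      ← smul_eq_mul, ← map_smul, ← map_smul, ← map_add]
    simp
  · rw [covariance_eq_sub (hG.memLp W h (by simp)) (hG.memLp W k (by simp)),
      hG.integral_eq_zero W, zero_mul, sub_zero, ← hk, ← W.inner_map_map, Submodule.coe_inner,
      L2.inner_def]
    simp [mul_comm]

/-- Write `h = c k + (h - c k)` with the second part orthogonal to `k`. Its image is centered and
independent of `W k`, so it contributes nothing, and the rest is the one-dimensional moment
recursion. -/
theorem IsGaussianHilbertSpace.integral_mul_pow (h k : H) (n : ℕ) :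
    ∫ ω, (W h : Lp ℝ 2 P) ω * (W k : Lp ℝ 2 P) ω ^ n ∂P =
      n * ⟪h, k⟫ * ∫ ω, (W k : Lp ℝ 2 P) ω ^ (n - 1) ∂P := by
  rcases eq_or_ne k 0 with rfl | hk
  · rcases n with _ | n
    · simp [hG.integral_eq_zero W]
    · rw [inner_zero_right, mul_zero, zero_mul]
      refine integral_eq_zero_of_ae ?_
      exact Filter.Eventually.of_forall fun ω => by simp
  · set c := ⟪h, k⟫ / ⟪k, k⟫ with hc
    have hkk : ⟪k, k⟫ ≠ 0 := inner_self_ne_zero.2 hk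
    have horth : ⟪h - c • k, k⟫ = 0 := by
      rw [inner_sub_left, real_inner_smul_left, hc, div_mul_cancel₀ _ hkk, sub_self]
    have hind := (hG.indepFun W horth).comp measurable_id (measurable_id.pow_const n)
    have h0 := hind.integral_fun_mul_eq_mul_integral
      (Lp.stronglyMeasurable (W (h - c • k) : Lp ℝ 2 P)).aestronglyMeasurable
      ((Lp.stronglyMeasurable (W k : Lp ℝ 2 P)).measurable.pow_const n).aestronglyMeasurable
    simp only [Function.comp_apply, id_eq, hG.integral_eq_zero W, zero_mul] at h0
    have hae : ∀ᵐ ω ∂P, (W h : Lp ℝ 2 P) ω * (W k : Lp ℝ 2 P) ω ^ n =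
        c * (W k : Lp ℝ 2 P) ω ^ (n + 1) +
          (W (h - c • k) : Lp ℝ 2 P) ω * (W k : Lp ℝ 2 P) ω ^ n := by
      have h2 := coeFn_map_smul_add W c k (h - c • k)
      rw [add_sub_cancel] at h2
      filter_upwards [h2] with ω h2
      rw [h2]
      ring
    have hi1 := hG.integrable_polyRV W (MvPolynomial.X k ^ (n + 1))
    have hi2 := hG.integrable_polyRV W (MvPolynomial.X (h - c • k) * MvPolynomial.X k ^ n)
    simp only [funext (polyRV_pow W _ _), funext (polyRV_mul W _ _), polyRV_pow, polyRV_X]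
      at hi1 hi2
    rw [integral_congr_ae hae, integral_add (hi1.const_mul c) hi2, integral_const_mul, h0,
      hG.integral_pow_succ, add_zero, hc]
    field_simp

/-- Gaussian integration by parts for polynomials. -/
theorem IsGaussianHilbertSpace.integral_X_mul (h : H) (p : MvPolynomial H ℝ) :
    ∫ ω, polyRV W (MvPolynomial.X h * p) ω ∂P = ∫ ω, polyRV W (dirDeriv h p) ω ∂P := by
  -- Both sides are linear in `p`, so by polarization powers of linear forms are enough.
  have hp : p ∈ Submodule.span ℝ _ := (span_pow_linear_eq_top H).symm ▸ Submodule.mem_top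
  induction hp using Submodule.span_induction with
  | mem p hp =>
    obtain ⟨l, hl, n, rfl⟩ := hp
    obtain ⟨k, hk, hk'⟩ := exists_dirDeriv_eq_of_mem_span W hl
    have h1 : ∫ ω, polyRV W (MvPolynomial.X h * l ^ n) ω ∂P =
        ∫ ω, (W h : Lp ℝ 2 P) ω * (W k : Lp ℝ 2 P) ω ^ n ∂P := by
      refine integral_congr_ae ?_
      filter_upwards [hk'] with ω h1
      simp [h1]
    rw [h1, hG.integral_mul_pow W, ← integral_const_mul]
    refine integral_congr_ae ?_
    filter_upwards [hk'] with ω h1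
    rw [Derivation.leibniz_pow, hk, nsmul_eq_mul, smul_eq_mul, ← map_natCast MvPolynomial.C]
    simp only [polyRV_mul, polyRV_C, polyRV_pow, h1]
    ring
  | zero => simp
  | add x y _ _ hx hy =>
    simp_rw [mul_add, map_add, polyRV_add]
    rw [integral_add (hG.integrable_polyRV W _) (hG.integrable_polyRV W _),
      integral_add (hG.integrable_polyRV W _) (hG.integrable_polyRV W _), hx, hy]
  | smul a x _ hx =>
    rw [Derivation.map_smul, mul_smul_comm]
    simp_rw [polyRV_smul, integral_const_mul, hx]

/-- Integration by parts for the product `p * q` combined with the Leibniz rule: the adjoint of `∂ₕ`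
on polynomials is `p ↦ X h * p - ∂ₕ p`. -/
theorem IsGaussianHilbertSpace.integral_mul_dirDeriv (h : H) (p q : MvPolynomial H ℝ) :
    ∫ ω, polyRV W p ω * polyRV W (dirDeriv h q) ω ∂P =
      ∫ ω, polyRV W (MvPolynomial.X h * p - dirDeriv h p) ω * polyRV W q ω ∂P := by
  have h1 := hG.integral_X_mul W h (p * q)
  rw [dirDeriv_mul] at h1
  simp_rw [polyRV_add] at h1
  rw [integral_add (hG.integrable_polyRV W _) (hG.integrable_polyRV W _)] at h1
  simp_rw [← polyRV_mul, sub_mul, polyRV_sub]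
  rw [integral_sub (hG.integrable_polyRV W _) (hG.integrable_polyRV W _), mul_assoc, h1,
    mul_comm (dirDeriv h p) q]
  ring

/-- The isometry formula for `δ(p(W) h) = p(W) W(h) - ∂ₕp(W)`. -/
theorem IsGaussianHilbertSpace.integral_skorohod_mul (h k : H) (p q : MvPolynomial H ℝ) :
    ∫ ω, polyRV W (MvPolynomial.X h * p - dirDeriv h p) ω *
        polyRV W (MvPolynomial.X k * q - dirDeriv k q) ω ∂P =
      ⟪h, k⟫ * ∫ ω, polyRV W p ω * polyRV W q ω ∂P +
        ∫ ω, polyRV W (dirDeriv k p) ω * polyRV W (dirDeriv h q) ω ∂P := by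
  -- The commutation relation between `∂ₕ` and the adjoint of `∂ₖ`: their commutator is the scalar
  -- `⟪h, k⟫`, the source of the term `E⟪u, v⟫`. The remaining term becomes the trace after one more
  -- integration by parts.
  have hcomm : dirDeriv h (MvPolynomial.X k * q - dirDeriv k q) =
      ⟪h, k⟫ • q + (MvPolynomial.X k * dirDeriv h q - dirDeriv k (dirDeriv h q)) := by
    rw [map_sub, dirDeriv_mul, dirDeriv_X, dirDeriv_comm, MvPolynomial.smul_eq_C_mul]
    ring
  have h2 := hG.integral_mul_dirDeriv W k (dirDeriv h q) p
  simp_rw [← polyRV_mul] at h2 ⊢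
  have h1 := hG.integral_mul_dirDeriv W h p (MvPolynomial.X k * q - dirDeriv k q)
  simp_rw [← polyRV_mul] at h1
  rw [← h1, hcomm, mul_add, mul_smul_comm]
  simp_rw [polyRV_add, polyRV_smul]
  rw [integral_add ((hG.integrable_polyRV W _).const_mul _) (hG.integrable_polyRV W _),
    integral_const_mul, mul_comm p (_ - _), ← h2, mul_comm (dirDeriv h q)]

end GaussianHilbert

/-! ### Determination of laws by moments and by linear combinations -/

section Moments

/-- Exponential integrability makes both moment generating functions analytic on all of `ℝ`, with
Taylor coefficients at `0` given by the moments. They therefore agree everywhere, and so do their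
complex extensions, which determine the laws. -/
theorem map_eq_map_of_moments_eq {Ω : Type*} [MeasurableSpace Ω] {μ ν : Measure Ω}
    [IsFiniteMeasure μ] [IsFiniteMeasure ν] {X : Ω → ℝ} (hX : Measurable X)
    (hμ : ∀ t, Integrable (fun ω => Real.exp (t * X ω)) μ)
    (hν : ∀ t, Integrable (fun ω => Real.exp (t * X ω)) ν)
    (h : ∀ n : ℕ, ∫ ω, X ω ^ n ∂μ = ∫ ω, X ω ^ n ∂ν) : μ.map X = ν.map X := by
  have hμ' : integrableExpSet X μ = Set.univ := Set.eq_univ_iff_forall.2 hμ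
  have hν' : integrableExpSet X ν = Set.univ := Set.eq_univ_iff_forall.2 hν
  have hmgf : mgf X μ = mgf X ν := by
    have h1 := hasFPowerSeriesAt_mgf (X := X) (μ := μ) (v := 0) (by simp [hμ'])
    have h2 := hasFPowerSeriesAt_mgf (X := X) (μ := ν) (v := 0) (by simp [hν'])
    simp only [zero_mul, Real.exp_zero, mul_one, h] at h1 h2
    have h3 : AnalyticOnNhd ℝ (mgf X μ) Set.univ := by
      simpa [hμ'] using analyticOnNhd_mgf (X := X) (μ := μ)
    have h4 : AnalyticOnNhd ℝ (mgf X ν) Set.univ := by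
      simpa [hν'] using analyticOnNhd_mgf (X := X) (μ := ν)
    refine h3.eq_of_eventuallyEq h4 (z₀ := 0) ?_
    have h5 := h1.sub h2
    rw [sub_self] at h5
    filter_upwards [h5.eventually_eq_zero] with t ht
    exact sub_eq_zero.1 ht
  -- The moment of order `0` is the total mass.
  have h0 : μ = 0 ↔ ν = 0 := by
    have := h 0
    simp only [pow_zero, integral_const, smul_eq_mul, mul_one] at this
    rw [← Measure.measure_univ_eq_zero, ← measureReal_eq_zero_iff, this, measureReal_eq_zero_iff,
      Measure.measure_univ_eq_zero]
  refine Measure.ext_of_complexMGF_eq hX.aemeasurable hX.aemeasurable (funext fun z => ?_)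
  exact eqOn_complexMGF_of_mgf' hmgf h0 (by simp [hμ'])

/-- The Cramér-Wold device: the law of a process is determined by the laws of the linear
combinations of its coordinates. -/
theorem map_pi_eq_of_map_sum_eq {Ω T : Type*} [MeasurableSpace Ω] {μ ν : Measure Ω}
    [IsFiniteMeasure μ] [IsFiniteMeasure ν] {X : T → Ω → ℝ} (hX : ∀ t, Measurable (X t))
    (h : ∀ (I : Finset T) (c : I → ℝ), μ.map (fun ω => ∑ i, c i * X i ω) =
      ν.map (fun ω => ∑ i, c i * X i ω)) :
    μ.map (fun ω t => X t ω) = ν.map (fun ω t => X t ω) := by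
  classical
  have hm : Measurable fun ω t => X t ω := measurable_pi_lambda _ hX
  refine IsProjectiveLimit.unique (P := fun I => (μ.map (fun ω t => X t ω)).map I.restrict)
    (fun I => rfl) fun I => ?_
  have hI : Measurable (I.restrict (π := fun _ : T => ℝ)) := Finset.measurable_restrict I
  refine Measure.ext_of_charFunDual (funext fun L => ?_)
  rw [charFunDual_eq_charFun_map_one, charFunDual_eq_charFun_map_one,
    Measure.map_map (by fun_prop) hI, Measure.map_map (by fun_prop) hI,
    Measure.map_map (by fun_prop) hm, Measure.map_map (by fun_prop) hm]
  have hL : ((L ∘ I.restrict) ∘ fun ω t => X t ω) =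
      fun ω => ∑ i : I, L (Pi.single i 1) * X i ω := by
    funext ω
    conv_lhs => rw [Function.comp_apply, Function.comp_apply,
      ← Finset.univ_sum_single (I.restrict fun t => X t ω), map_sum]
    refine Finset.sum_congr rfl fun i _ => ?_
    rw [mul_comm, ← smul_eq_mul, ← map_smul, ← Pi.single_smul, smul_eq_mul, mul_one]
    rfl
  rw [hL, h I]

end Moments

/-! ### Totality of polynomials in `L²` -/

section Density

variable {Ω : Type*} [MeasurableSpace Ω] {P : Measure Ω}
variable {H₁ : Submodule ℝ (Lp ℝ 2 P)}
variable {H : Type*} [NormedAddCommGroup H] [InnerProductSpace ℝ H]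
variable (W : H ≃ₗᵢ[ℝ] H₁)

theorem measurable_coeFn (ξ : Lp ℝ 2 P) : Measurable (ξ : Ω → ℝ) :=
  (Lp.stronglyMeasurable ξ).measurable

include W in
-- A linear combination of elements of `H₁` is almost surely some `W k`, so the Cramér-Wold device
-- gives equality on `σ(H₁)`. Absolute continuity transfers the `P`-almost sure identities, and the
-- passage from `σ(H₁)` to all measurable sets, to `μ` and `ν`.
theorem IsGeneratedBy.measure_eq (hgen : IsGeneratedBy H₁) {μ ν : Measure Ω} [IsFiniteMeasure μ]
    [IsFiniteMeasure ν] (hμ : μ ≪ P) (hν : ν ≪ P)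
    (h : ∀ k, μ.map (W k : Lp ℝ 2 P) = ν.map (W k : Lp ℝ 2 P)) : μ = ν := by
  have hm : Measurable fun ω (ξ : H₁) => (ξ : Lp ℝ 2 P) ω :=
    measurable_pi_lambda _ fun ξ => measurable_coeFn _
  refine Measure.ext fun s hs => ?_
  obtain ⟨t, ht, hst⟩ := hgen s hs
  have hσ : sigmaField H₁ =
      MeasurableSpace.comap (fun ω (ξ : H₁) => (ξ : Lp ℝ 2 P) ω) MeasurableSpace.pi :=
    (MeasurableSpace.comap_process_pi fun (ξ : H₁) ω => (ξ : Lp ℝ 2 P) ω).symm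
  rw [hσ] at ht
  obtain ⟨t', ht', rfl⟩ := ht
  rw [measure_congr (hμ.ae_le hst), measure_congr (hν.ae_le hst), ← Measure.map_apply hm ht',
    ← Measure.map_apply hm ht', map_pi_eq_of_map_sum_eq (μ := μ) (ν := ν)
      (fun ξ : H₁ => measurable_coeFn (ξ : Lp ℝ 2 P)) fun I c => ?_]
  have hae := coeFn_map_sum W Finset.univ c (fun i : I => W.symm i)
  simp only [LinearIsometryEquiv.apply_symm_apply] at hae
  rw [← Measure.map_congr (hμ.ae_le hae), ← Measure.map_congr (hν.ae_le hae), h]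

/-- Polynomials in the Gaussian random variables are total in `L²`. -/
theorem IsGaussianHilbertSpace.eq_zero_of_integral_mul_polyRV_eq_zero [IsProbabilityMeasure P]
    (hG : IsGaussianHilbertSpace H₁) (hgen : IsGeneratedBy H₁) (X : Lp ℝ 2 P)
    (hX : ∀ p, ∫ ω, X ω * polyRV W p ω ∂P = 0) : X = 0 := by
  have hXm := measurable_coeFn X
  have hpos : ∀ Y : Ω → ℝ, MemLp Y 2 P → MemLp (fun ω => ((Y ω).toNNReal : ℝ)) 2 P := fun Y hY =>
    hY.mono (by
      simpa using!
        (hY.aestronglyMeasurable.aemeasurable.max aemeasurable_const).aestronglyMeasurable)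
      (Filter.Eventually.of_forall fun ω => by
        rw [Real.coe_toNNReal', Real.norm_eq_abs, Real.norm_eq_abs, abs_of_nonneg (le_max_right _ _)]
        exact max_le (le_abs_self _) (abs_nonneg _))
  have hfin : ∀ Y : Ω → ℝ, MemLp Y 2 P →
      IsFiniteMeasure (P.withDensity fun ω => ENNReal.ofReal (Y ω)) := fun Y hY =>
    isFiniteMeasure_withDensity_ofReal (hY.integrable (by norm_num)).2
  have hX2 := Lp.memLp X
  have := hfin _ hX2
  have := hfin _ hX2.neg
  have hint : ∀ (Y : Ω → ℝ), Measurable Y → MemLp Y 2 P → ∀ f : Ω → ℝ, MemLp f 2 P →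
      Integrable f (P.withDensity fun ω => ENNReal.ofReal (Y ω)) := fun Y hYm hY f hf => by
    refine (integrable_withDensity_iff_integrable_smul hYm.real_toNNReal).2 ?_
    exact (hpos Y hY).integrable_mul hf
  have hexp : ∀ h t, MemLp (fun ω => Real.exp (t * (W h : Lp ℝ 2 P) ω)) 2 P := fun h t => by
    refine (memLp_two_iff_integrable_sq (hG.integrable_exp_mul W h t).1).2 ?_
    refine (hG.integrable_exp_mul W h (2 * t)).congr (Filter.Eventually.of_forall fun ω => ?_)
    simp only
    rw [sq, ← Real.exp_add]
    ring_nf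
  -- The two densities are `X⁺` and `X⁻`. Orthogonality of `X` to the powers of `W k` says that both
  -- measures give `W k` the same moments.
  have heq : P.withDensity (fun ω => ENNReal.ofReal (X ω)) =
      P.withDensity (fun ω => ENNReal.ofReal ((-X : Ω → ℝ) ω)) := by
    refine hgen.measure_eq W (withDensity_absolutelyContinuous _ _)
      (withDensity_absolutelyContinuous _ _) fun k => ?_
    refine map_eq_map_of_moments_eq (measurable_coeFn _)
      (fun t => hint _ hXm hX2 _ (hexp k t)) (fun t => hint _ hXm.neg hX2.neg _ (hexp k t))
      fun n => ?_
    have h1 := integral_withDensity_eq_integral_smul (μ := P) hXm.real_toNNReal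
      (fun ω => (W k : Lp ℝ 2 P) ω ^ n)
    have h2 := integral_withDensity_eq_integral_smul (μ := P) hXm.neg.real_toNNReal
      (fun ω => (W k : Lp ℝ 2 P) ω ^ n)
    refine h1.trans (Eq.trans ?_ h2.symm)
    have hp := hG.memLp_polyRV W (MvPolynomial.X k ^ n) (q := 2) (by simp)
    have h3 := hX (MvPolynomial.X k ^ n)
    simp only [polyRV_pow, polyRV_X, funext (polyRV_pow W _ _)] at h3 hp
    rw [← sub_eq_zero]
    have hi1 := (hpos _ hX2).integrable_mul hp
    have hi2 := (hpos _ hX2.neg).integrable_mul hp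
    refine (integral_sub hi1 hi2).symm.trans (Eq.trans (integral_congr_ae ?_) h3)
    refine Filter.Eventually.of_forall fun ω => ?_
    simp only [Pi.mul_apply, Pi.neg_apply, Real.coe_toNNReal']
    rw [← sub_mul]
    congr 1
    rcases le_total (X ω) 0 with h | h
    · rw [max_eq_right h, max_eq_left (by linarith)]; ring
    · rw [max_eq_left h, max_eq_right (by linarith)]; ring
  have hne : ∫⁻ ω, ENNReal.ofReal (X ω) ∂P ≠ ∞ := by
    rw [← setLIntegral_univ, ← withDensity_apply _ MeasurableSet.univ]
    exact measure_ne_top _ _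
  have hae := (withDensity_eq_iff hXm.ennreal_ofReal.aemeasurable
    hXm.neg.ennreal_ofReal.aemeasurable hne).1 heq
  refine Lp.ext ?_
  filter_upwards [hae, Lp.coeFn_zero ℝ 2 P] with ω h1 h2
  rw [h2, Pi.zero_apply]
  rcases le_total (X ω) 0 with h | h
  · rw [ENNReal.ofReal_of_nonpos h, eq_comm, ENNReal.ofReal_eq_zero, Pi.neg_apply] at h1
    linarith
  · rw [ENNReal.ofReal_of_nonpos (p := (-X : Ω → ℝ) ω) (by simpa using h),
      ENNReal.ofReal_eq_zero] at h1
    linarith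

end Density

/-! ### Extension of identities and estimates to closures -/

section Closure

variable {E F : Type*} [NormedAddCommGroup E] [NormedSpace ℝ E] [NormedAddCommGroup F]
  [NormedSpace ℝ F]

theorem eq_of_mem_topologicalClosure_span {f g : E →L[ℝ] ℝ} {s : Set E}
    (h : ∀ x ∈ s, f x = g x) {x : E} (hx : x ∈ (Submodule.span ℝ s).topologicalClosure) :
    f x = g x :=
  ContinuousLinearMap.eqOn_closure_span (f := f) (g := g) h hx

theorem eq_of_mem_topologicalClosure_span₂ {f g : E →L[ℝ] F →L[ℝ] ℝ} {s : Set E} {t : Set F}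
    (h : ∀ x ∈ s, ∀ y ∈ t, f x y = g x y) {x : E}
    (hx : x ∈ (Submodule.span ℝ s).topologicalClosure) {y : F}
    (hy : y ∈ (Submodule.span ℝ t).topologicalClosure) : f x y = g x y :=
  eq_of_mem_topologicalClosure_span (f := f.flip y) (g := g.flip y)
    (fun z hz => eq_of_mem_topologicalClosure_span (f := f z) (g := g z) (h z hz) hy) hx

/-- The first component of a closed relation is closed if it controls the second one. -/
theorem exists_mem_topologicalClosure_of_norm_le [CompleteSpace F] {G : Submodule ℝ E}
    {Γ : Submodule ℝ (E × F)} (hG : ∀ x ∈ G, ∃ y, (x, y) ∈ Γ) {K : ℝ}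
    (hK : ∀ z ∈ Γ, ‖z.2‖ ≤ K * ‖z.1‖) {x : E} (hx : x ∈ G.topologicalClosure) :
    ∃ y, (x, y) ∈ Γ.topologicalClosure := by
  obtain ⟨u, hu, hux⟩ := mem_closure_iff_seq_limit.1 (show x ∈ closure (G : Set E) from hx)
  choose y hy using fun n => hG (u n) (hu n)
  have hcauchy : CauchySeq y := by
    refine Metric.cauchySeq_iff.2 fun ε hε => ?_
    -- The denominator `|K| + 1` is positive whatever the sign of `K`.
    obtain ⟨N, hN⟩ := Metric.cauchySeq_iff.1 hux.cauchySeq (ε / (|K| + 1)) (by positivity)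
    refine ⟨N, fun m hm n hn => ?_⟩
    have h1 := hN m hm n hn
    have h2 := hK _ (Γ.sub_mem (hy m) (hy n))
    rw [dist_eq_norm] at h1 ⊢
    rw [lt_div_iff₀ (by positivity)] at h1
    refine lt_of_le_of_lt (h2.trans ?_) h1
    rw [mul_comm]
    exact mul_le_mul_of_nonneg_left ((le_abs_self K).trans (by linarith)) (norm_nonneg _)
  obtain ⟨z, hz⟩ := cauchySeq_tendsto_of_complete hcauchy
  exact ⟨z, mem_closure_of_tendsto (hux.prodMk_nhds hz) (Filter.Eventually.of_forall hy)⟩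

end Closure

/-! ### Closability of the derivatives and closure of the elementary triples -/

section Graphs

variable {Ω : Type*} [MeasurableSpace Ω] {P : Measure Ω}
variable {H₁ : Submodule ℝ (Lp ℝ 2 P)}
variable {H : Type*} [NormedAddCommGroup H] [InnerProductSpace ℝ H]
variable (W : H ≃ₗᵢ[ℝ] H₁)

theorem IsPolynomialDeriv.exists_polyRV {F : Lp ℝ 2 P} {DF : Lp H 2 P}
    (h : IsPolynomialDeriv W F DF) : ∃ p : MvPolynomial H ℝ, F =ᵐ[P] polyRV W p ∧
      ∀ k, ∀ᵐ ω ∂P, ⟪k, DF ω⟫ = polyRV W (dirDeriv k p) ω := by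
  obtain ⟨m, g, p, h1, h2⟩ := h
  refine ⟨MvPolynomial.rename g p, ?_, fun k => ?_⟩
  · filter_upwards [h1] with ω h
    rw [h, polyRV_rename]
  · filter_upwards [h2] with ω h
    rw [h, dirDeriv_rename, inner_sum]
    simp only [polyRV, map_sum, map_mul, MvPolynomial.eval_C, MvPolynomial.eval_rename,
      inner_smul_right]
    exact Finset.sum_congr rfl fun i _ => mul_comm _ _

theorem IsGaussianHilbertSpace.exists_isPolynomialDeriv [IsProbabilityMeasure P]
    (hG : IsGaussianHilbertSpace H₁) (p : MvPolynomial H ℝ) :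
    ∃ (F : Lp ℝ 2 P) (DF : Lp H 2 P), IsPolynomialDeriv W F DF ∧ F =ᵐ[P] polyRV W p := by
  obtain ⟨m, g, -, q, rfl⟩ := MvPolynomial.exists_fin_rename p
  have hF := hG.memLp_polyRV W (MvPolynomial.rename g q) (q := 2) (by simp)
  have hD : MemLp (fun ω => ∑ i, MvPolynomial.eval (fun j => (W (g j) : Lp ℝ 2 P) ω)
      (MvPolynomial.pderiv i q) • g i) 2 P := by
    refine memLp_finsetSum _ fun i _ => ?_
    have h := hG.memLp_polyRV W (MvPolynomial.rename g (MvPolynomial.pderiv i q)) (q := 2)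
      (by simp)
    rw [funext (polyRV_rename W g _)] at h
    exact ((ContinuousLinearMap.id ℝ ℝ).smulRight (g i)).comp_memLp' h
  refine ⟨hF.toLp _, hD.toLp _, ⟨m, g, q, ?_, hD.coeFn_toLp⟩, hF.coeFn_toLp⟩
  filter_upwards [hF.coeFn_toLp] with ω h
  rw [h, polyRV_rename]

variable [IsProbabilityMeasure P]

/-- The random variable `p(W)` as an element of `L²`. -/
noncomputable def IsGaussianHilbertSpace.polyLp (hG : IsGaussianHilbertSpace H₁)
    (p : MvPolynomial H ℝ) : Lp ℝ 2 P :=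
  (hG.memLp_polyRV W p (by simp)).toLp _

theorem IsGaussianHilbertSpace.coeFn_polyLp (hG : IsGaussianHilbertSpace H₁)
    (p : MvPolynomial H ℝ) : hG.polyLp W p =ᵐ[P] polyRV W p :=
  MemLp.coeFn_toLp _

/-- The functional `(f, g) ↦ E[L(f) g]` on `L²(Ω; E) × L²(Ω)`, for a continuous functional `L`. -/
noncomputable def dualPairing (P : Measure Ω) {E : Type*} [NormedAddCommGroup E] [NormedSpace ℝ E]
    (L : E →L[ℝ] ℝ) : Lp E 2 P →L[ℝ] Lp ℝ 2 P →L[ℝ] ℝ :=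
  ((ContinuousLinearMap.mul ℝ ℝ).comp L).lpPairing P 2 2

omit [IsProbabilityMeasure P] in
theorem dualPairing_apply {E : Type*} [NormedAddCommGroup E] [NormedSpace ℝ E]
    (L : E →L[ℝ] ℝ) (f : Lp E 2 P) (g : Lp ℝ 2 P) :
    dualPairing P L f g = ∫ ω, L (f ω) * g ω ∂P :=
  ContinuousLinearMap.lpPairing_eq_integral _ f g

theorem IsGaussianHilbertSpace.ae_eq_zero_of_dualPairing_eq_zero (hG : IsGaussianHilbertSpace H₁)
    (hgen : IsGeneratedBy H₁) {E : Type*} [NormedAddCommGroup E] [NormedSpace ℝ E]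
    (L : E →L[ℝ] ℝ) (f : Lp E 2 P) (h : ∀ p, dualPairing P L f (hG.polyLp W p) = 0) :
    ∀ᵐ ω ∂P, L (f ω) = 0 := by
  have h1 : L.compLp f = 0 := by
    refine hG.eq_zero_of_integral_mul_polyRV_eq_zero W hgen _ fun p => ?_
    rw [← h p, dualPairing_apply]
    refine integral_congr_ae ?_
    filter_upwards [L.coeFn_compLp f, hG.coeFn_polyLp W p] with ω h1 h2
    rw [h1, h2]
  filter_upwards [L.coeFn_compLp f, (Lp.ext_iff.1 h1), Lp.coeFn_zero ℝ 2 P] with ω h2 h3 h4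
  rw [← h2, h3, h4, Pi.zero_apply]

/-- Integration by parts moves the derivative onto the polynomial test function. Both sides are then
continuous in `x`, so the identity survives the closure; this is what makes `D` closable. -/
theorem IsGaussianHilbertSpace.dualPairing_deriv (hG : IsGaussianHilbertSpace H₁)
    (h : H) (p : MvPolynomial H ℝ) {x : Lp ℝ 2 P × Lp H 2 P}
    (hx : x ∈ (polynomialGraph W).topologicalClosure) :
    dualPairing P (innerSL ℝ h) x.2 (hG.polyLp W p) = dualPairing P (ContinuousLinearMap.id ℝ ℝ) x.1
      (hG.polyLp W (MvPolynomial.X h * p - dirDeriv h p)) := by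
  refine eq_of_mem_topologicalClosure_span
    (f := ((dualPairing P (innerSL ℝ h)).flip (hG.polyLp W p)).comp
      (ContinuousLinearMap.snd ℝ (Lp ℝ 2 P) (Lp H 2 P)))
    (g := ((dualPairing P (ContinuousLinearMap.id ℝ ℝ)).flip
      (hG.polyLp W (MvPolynomial.X h * p - dirDeriv h p))).comp
      (ContinuousLinearMap.fst ℝ (Lp ℝ 2 P) (Lp H 2 P))) (fun x hx => ?_) hx
  obtain ⟨q, h1, h2⟩ := IsPolynomialDeriv.exists_polyRV W hx
  simp only [ContinuousLinearMap.comp_apply, ContinuousLinearMap.flip_apply,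
    ContinuousLinearMap.coe_fst', ContinuousLinearMap.coe_snd', dualPairing_apply,
    innerSL_apply_apply, ContinuousLinearMap.id_apply]
  have key := hG.integral_mul_dirDeriv W h p q
  refine Eq.trans (integral_congr_ae ?_) (key.trans (integral_congr_ae ?_))
  · filter_upwards [h2 h, hG.coeFn_polyLp W p] with ω h3 h4
    rw [h3, h4, mul_comm]
  · filter_upwards [h1, hG.coeFn_polyLp W (MvPolynomial.X h * p - dirDeriv h p)] with ω h3 h4
    rw [h3, h4, mul_comm]

/-- If the first component vanishes, each `⟪h, x.2⟫` is orthogonal to all polynomials, hence zero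
almost surely. Separability of `H` reduces the choice of `h` to countably many null sets. -/
theorem IsGaussianHilbertSpace.malliavinDeriv_closable (hG : IsGaussianHilbertSpace H₁)
    (hgen : IsGeneratedBy H₁) [TopologicalSpace.SeparableSpace H] (x : Lp ℝ 2 P × Lp H 2 P)
    (hx : x ∈ (polynomialGraph W).topologicalClosure) (h0 : x.1 = 0) : x.2 = 0 := by
  have : SecondCountableTopology H := UniformSpace.secondCountable_of_separable H
  have h1 : x.2 =ᵐ[P] 0 := ae_eq_zero_of_forall_inner (𝕜 := ℝ) fun h => by
    refine hG.ae_eq_zero_of_dualPairing_eq_zero W hgen (innerSL ℝ h) x.2 fun p => ?_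
    rw [hG.dualPairing_deriv W h p hx, h0, map_zero, zero_apply]
  exact Lp.ext (h1.trans (Lp.coeFn_zero H 2 P).symm)

theorem IsGaussianHilbertSpace.dense_malliavinDeriv_domain (hG : IsGaussianHilbertSpace H₁)
    (hgen : IsGeneratedBy H₁) : Dense ((malliavinDeriv W).domain : Set (Lp ℝ 2 P)) := by
  rw [Submodule.dense_iff_topologicalClosure_eq_top, Submodule.topologicalClosure_eq_top_iff,
    Submodule.eq_bot_iff]
  intro X hX
  refine hG.eq_zero_of_integral_mul_polyRV_eq_zero W hgen X fun p => ?_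
  obtain ⟨F, DF, h1, h2⟩ := hG.exists_isPolynomialDeriv W p
  have hF : F ∈ (malliavinDeriv W).domain :=
    ⟨(F, DF), Submodule.le_topologicalClosure _ (Submodule.subset_span h1), rfl⟩
  rw [← (Submodule.mem_orthogonal _ _).1 hX F hF, L2.inner_def]
  refine integral_congr_ae ?_
  filter_upwards [h2] with ω h3
  simp [h3]

variable [CompleteSpace H]

/-- The operator-valued counterpart: the test functional is `S ↦ Tr(S (k ⊗ h)) = ⟪S h, k⟫`. -/
theorem IsGaussianHilbertSpace.dualPairing_derivIn (hG : IsGaussianHilbertSpace H₁)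
    (h k : H) (p : MvPolynomial H ℝ) {x : Lp H 2 P × Lp (HilbertSchmidt H H) 2 P}
    (hx : x ∈ (polynomialGraphIn H W).topologicalClosure) :
    dualPairing P ((HilbertSchmidt.traceComp (fixedBasis H)).flip (HilbertSchmidt.tensor k h)) x.2
      (hG.polyLp W p) = dualPairing P (innerSL ℝ k) x.1
      (hG.polyLp W (MvPolynomial.X h * p - dirDeriv h p)) := by
  refine eq_of_mem_topologicalClosure_span
    (f := ((dualPairing P ((HilbertSchmidt.traceComp (fixedBasis H)).flip
        (HilbertSchmidt.tensor k h))).flip (hG.polyLp W p)).comp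
      (ContinuousLinearMap.snd ℝ (Lp H 2 P) (Lp (HilbertSchmidt H H) 2 P)))
    (g := ((dualPairing P (innerSL ℝ k)).flip
      (hG.polyLp W (MvPolynomial.X h * p - dirDeriv h p))).comp
      (ContinuousLinearMap.fst ℝ (Lp H 2 P) (Lp (HilbertSchmidt H H) 2 P))) (fun x hx => ?_) hx
  obtain ⟨F, DF, v, hF, hx1, hx2⟩ := hx
  obtain ⟨q, h1, h2⟩ := IsPolynomialDeriv.exists_polyRV W hF
  simp only [ContinuousLinearMap.comp_apply, ContinuousLinearMap.flip_apply,
    ContinuousLinearMap.coe_fst', ContinuousLinearMap.coe_snd', dualPairing_apply,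
    innerSL_apply_apply]
  have key := congrArg (fun r => ⟪k, v⟫ * r) (hG.integral_mul_dirDeriv W h p q)
  simp only [← integral_const_mul] at key
  refine Eq.trans (integral_congr_ae ?_) (key.trans (integral_congr_ae ?_))
  · filter_upwards [h2 h, hG.coeFn_polyLp W p, hx2] with ω h3 h4 h5
    rw [h5, HilbertSchmidt.traceComp_tensor, real_inner_comm, h3, h4]
    ring
  · filter_upwards [h1, hG.coeFn_polyLp W (MvPolynomial.X h * p - dirDeriv h p), hx1]
      with ω h3 h4 h5
    rw [h5, h4, h3, real_inner_smul_right]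
    ring

theorem IsGaussianHilbertSpace.malliavinDerivIn_closable (hG : IsGaussianHilbertSpace H₁)
    (hgen : IsGeneratedBy H₁) [TopologicalSpace.SeparableSpace H]
    (x : Lp H 2 P × Lp (HilbertSchmidt H H) 2 P)
    (hx : x ∈ (polynomialGraphIn H W).topologicalClosure) (h0 : x.1 = 0) : x.2 = 0 := by
  have : SecondCountableTopology H := UniformSpace.secondCountable_of_separable H
  have h1 : ∀ h : H, (fun ω => HilbertSchmidt.toCLM (x.2 ω) h) =ᵐ[P] 0 := fun h =>
    ae_eq_zero_of_forall_inner (𝕜 := ℝ) fun k => by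
      filter_upwards [hG.ae_eq_zero_of_dualPairing_eq_zero W hgen
        ((HilbertSchmidt.traceComp (fixedBasis H)).flip (HilbertSchmidt.tensor k h)) x.2
        fun p => by
          rw [hG.dualPairing_derivIn W h k p hx, h0, map_zero, zero_apply]]
        with ω hω
      rw [ContinuousLinearMap.flip_apply, HilbertSchmidt.traceComp_tensor_right] at hω
      rw [real_inner_comm, hω, Pi.zero_apply]
  -- A single null set serves a dense sequence of vectors, and a bounded operator vanishing on a
  -- dense set is zero.
  have h2 := ae_all_iff.2 fun n : ℕ => h1 (TopologicalSpace.denseSeq H n)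
  refine Lp.ext ?_
  filter_upwards [h2, Lp.coeFn_zero (HilbertSchmidt H H) 2 P] with ω h3 h4
  rw [h4, Pi.zero_apply]
  refine Subtype.ext (DFunLike.coe_injective ?_)
  exact (HilbertSchmidt.toCLM (x.2 ω)).continuous.ext_on (TopologicalSpace.denseRange_denseSeq H)
    continuous_const (by rintro _ ⟨n, rfl⟩; exact h3 n)

/-- The triples `(u, Du, δ(u))` for `u = F v`, with `F` a polynomial random variable. -/
def elementaryTriples (W : H ≃ₗᵢ[ℝ] H₁) :
    Set ((Lp H 2 P × Lp (HilbertSchmidt H H) 2 P) × Lp ℝ 2 P) :=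
  {x | ∃ (p : MvPolynomial H ℝ) (DF : Lp H 2 P) (v : H),
    (∀ k, ∀ᵐ ω ∂P, ⟪k, DF ω⟫ = polyRV W (dirDeriv k p) ω) ∧
    (∀ᵐ ω ∂P, x.1.1 ω = polyRV W p ω • v) ∧
    (∀ᵐ ω ∂P, x.1.2 ω = HilbertSchmidt.tensor (DF ω) v) ∧
    (∀ᵐ ω ∂P, x.2 ω = polyRV W (MvPolynomial.X v * p - dirDeriv v p) ω)}

theorem IsGaussianHilbertSpace.exists_mem_span_elementaryTriples (hG : IsGaussianHilbertSpace H₁)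
    (x : Lp H 2 P × Lp (HilbertSchmidt H H) 2 P) (hx : x ∈ polynomialGraphIn H W) :
    ∃ y, (x, y) ∈ Submodule.span ℝ (elementaryTriples W) := by
  induction hx using Submodule.span_induction with
  | mem x hx =>
    obtain ⟨F, DF, v, hF, hx1, hx2⟩ := hx
    obtain ⟨p, h1, h2⟩ := IsPolynomialDeriv.exists_polyRV W hF
    refine ⟨hG.polyLp W (MvPolynomial.X v * p - dirDeriv v p),
      Submodule.subset_span ⟨p, DF, v, h2, ?_, hx2, hG.coeFn_polyLp W _⟩⟩
    filter_upwards [h1, hx1] with ω h3 h4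
    rw [h4, h3]
  | zero => exact ⟨0, Submodule.zero_mem _⟩
  | add x y _ _ hx hy =>
    obtain ⟨a, ha⟩ := hx
    obtain ⟨b, hb⟩ := hy
    exact ⟨a + b, Submodule.add_mem _ ha hb⟩
  | smul c x _ hx =>
    obtain ⟨a, ha⟩ := hx
    exact ⟨c • a, Submodule.smul_mem _ c ha⟩

/-- The defining relation of the adjoint. It is continuous in both arguments, so
`integral_mul_dirDeriv` on generators suffices. -/
theorem IsGaussianHilbertSpace.inner_eq_of_mem_closure (hG : IsGaussianHilbertSpace H₁)
    {x : (Lp H 2 P × Lp (HilbertSchmidt H H) 2 P) × Lp ℝ 2 P}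
    (hx : x ∈ (Submodule.span ℝ (elementaryTriples W)).topologicalClosure)
    {y : Lp ℝ 2 P × Lp H 2 P} (hy : y ∈ (polynomialGraph W).topologicalClosure) :
    ⟪x.2, y.1⟫ = ⟪x.1.1, y.2⟫ := by
  refine eq_of_mem_topologicalClosure_span₂
    (f := (innerSL ℝ).bilinearComp (ContinuousLinearMap.snd ℝ _ _) (ContinuousLinearMap.fst ℝ _ _))
    (g := (innerSL ℝ).bilinearComp
      ((ContinuousLinearMap.fst ℝ _ _).comp (ContinuousLinearMap.fst ℝ _ _))
      (ContinuousLinearMap.snd ℝ _ _)) (fun x hx y hy => ?_) hx hy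
  obtain ⟨p, DF, v, -, hu, -, hξ⟩ := hx
  obtain ⟨q, h1, h2⟩ := IsPolynomialDeriv.exists_polyRV W hy
  simp only [ContinuousLinearMap.bilinearComp_apply, ContinuousLinearMap.comp_apply,
    ContinuousLinearMap.coe_fst', ContinuousLinearMap.coe_snd', innerSL_apply_apply, L2.inner_def]
  refine Eq.trans (integral_congr_ae ?_) ((hG.integral_mul_dirDeriv W v p q).symm.trans
    (integral_congr_ae ?_))
  · filter_upwards [hξ, h1] with ω h3 h4
    rw [h3, h4, RCLike.inner_apply, conj_trivial, mul_comm]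
  · filter_upwards [hu, h2 v] with ω h3 h4
    rw [h3, real_inner_smul_left, h4]

/-- Both sides are continuous bilinear forms, the trace term thanks to the Hilbert-Schmidt bound, so
it is enough to compare them on elementary triples, where this is `integral_skorohod_mul`. -/
theorem IsGaussianHilbertSpace.inner_eq_inner_add_trace (hG : IsGaussianHilbertSpace H₁)
    {ι : Type*} (b : HilbertBasis ι ℝ H)
    {x y : (Lp H 2 P × Lp (HilbertSchmidt H H) 2 P) × Lp ℝ 2 P}
    (hx : x ∈ (Submodule.span ℝ (elementaryTriples W)).topologicalClosure)
    (hy : y ∈ (Submodule.span ℝ (elementaryTriples W)).topologicalClosure) :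
    ⟪x.2, y.2⟫ = ⟪x.1.1, y.1.1⟫ +
      (HilbertSchmidt.traceComp b).lpPairing P 2 2 x.1.2 y.1.2 := by
  refine eq_of_mem_topologicalClosure_span₂
    (f := (innerSL ℝ).bilinearComp (ContinuousLinearMap.snd ℝ _ _) (ContinuousLinearMap.snd ℝ _ _))
    (g := (innerSL ℝ).bilinearComp
      ((ContinuousLinearMap.fst ℝ _ _).comp (ContinuousLinearMap.fst ℝ _ _))
      ((ContinuousLinearMap.fst ℝ _ _).comp (ContinuousLinearMap.fst ℝ _ _)) +
      ((HilbertSchmidt.traceComp b).lpPairing P 2 2).bilinearComp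
      ((ContinuousLinearMap.snd ℝ _ _).comp (ContinuousLinearMap.fst ℝ _ _))
      ((ContinuousLinearMap.snd ℝ _ _).comp (ContinuousLinearMap.fst ℝ _ _)))
    (fun x hx y hy => ?_) hx hy
  obtain ⟨p, DF, v, hD, hu, hT, hξ⟩ := hx
  obtain ⟨q, DF', w, hD', hu', hT', hξ'⟩ := hy
  simp only [ContinuousLinearMap.bilinearComp_apply, ContinuousLinearMap.comp_apply,
    add_apply, ContinuousLinearMap.coe_fst', ContinuousLinearMap.coe_snd',
    innerSL_apply_apply, L2.inner_def, ContinuousLinearMap.lpPairing_eq_integral]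
  refine Eq.trans (integral_congr_ae ?_) ((hG.integral_skorohod_mul W v w p q).trans ?_)
  · filter_upwards [hξ, hξ'] with ω h3 h4
    rw [h3, h4, RCLike.inner_apply, conj_trivial, mul_comm]
  · rw [← integral_const_mul]
    congr 1
    · refine integral_congr_ae ?_
      filter_upwards [hu, hu'] with ω h3 h4
      rw [h3, h4, real_inner_smul_left, real_inner_smul_right]
      ring
    · refine integral_congr_ae ?_
      filter_upwards [hT, hT', hD w, hD' v] with ω h3 h4 h5 h6
      rw [h3, h4, HilbertSchmidt.traceComp_tensor, real_inner_comm, h5, real_inner_comm, h6]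

/-- The isometry with `x = y` gives `‖δ(u)‖² ≤ ‖u‖² + ‖B‖ ‖Du‖²`, where `B` is the integrated trace
form; the constant is the square root of `1 + ‖B‖` since the product carries the maximum norm. -/
theorem IsGaussianHilbertSpace.norm_le_of_mem_span (hG : IsGaussianHilbertSpace H₁)
    {x : (Lp H 2 P × Lp (HilbertSchmidt H H) 2 P) × Lp ℝ 2 P}
    (hx : x ∈ Submodule.span ℝ (elementaryTriples W)) :
    ‖x.2‖ ≤ √(1 + ‖(HilbertSchmidt.traceComp (fixedBasis H)).lpPairing P 2 2‖) * ‖x.1‖ := by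
  have hx' := Submodule.le_topologicalClosure _ hx
  have h1 := hG.inner_eq_inner_add_trace W (fixedBasis H) hx' hx'
  rw [real_inner_self_eq_norm_sq, real_inner_self_eq_norm_sq] at h1
  set B := (HilbertSchmidt.traceComp (fixedBasis H)).lpPairing P 2 2
  have h2 : B x.1.2 x.1.2 ≤ ‖B‖ * ‖x.1‖ * ‖x.1‖ :=
    (le_abs_self _).trans ((B.le_opNorm₂ _ _).trans (by gcongr <;> exact norm_snd_le _))
  have h3 : ‖x.1.1‖ ^ 2 ≤ ‖x.1‖ ^ 2 := by
    gcongr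
    exact norm_fst_le _
  refine le_of_sq_le_sq ?_ (by positivity)
  rw [mul_pow, Real.sq_sqrt (by positivity)]
  linarith

theorem IsGaussianHilbertSpace.exists_mem_closure_elementaryTriples
    (hG : IsGaussianHilbertSpace H₁) {x : Lp H 2 P × Lp (HilbertSchmidt H H) 2 P}
    (hx : x ∈ (polynomialGraphIn H W).topologicalClosure) :
    ∃ y, (x, y) ∈ (Submodule.span ℝ (elementaryTriples W)).topologicalClosure :=
  exists_mem_topologicalClosure_of_norm_le (hG.exists_mem_span_elementaryTriples W)
    (fun _ hz => hG.norm_le_of_mem_span W hz) hx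

end Graphs

end Malliavin

/-! ### Identification of the divergence and conclusion -/

open Malliavin in
theorem mainTheorem7 {Ω : Type*} [MeasurableSpace Ω] (P : Measure Ω) [IsProbabilityMeasure P]
    (H₁ : Submodule ℝ (Lp ℝ 2 P)) (hGauss : IsGaussianHilbertSpace H₁) (hgen : IsGeneratedBy H₁)
    {H : Type*} [NormedAddCommGroup H] [InnerProductSpace ℝ H] [CompleteSpace H]
    [TopologicalSpace.SeparableSpace H] (W : H ≃ₗᵢ[ℝ] H₁)
    {ι : Type*} (b : HilbertBasis ι ℝ H) :
    ∃ hdom : (malliavinDerivIn H W).domain ≤ (divergence W).domain,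
      ∀ u v : (malliavinDerivIn H W).domain,
        (∀ᵐ ω ∂P, Summable fun i =>
          ⟪((malliavinDerivIn H W u ω).toCLM ∘L (malliavinDerivIn H W v ω).toCLM) (b i), b i⟫) ∧
        Integrable (fun ω => traceIn b
          ((malliavinDerivIn H W u ω).toCLM ∘L (malliavinDerivIn H W v ω).toCLM)) P ∧
        ∫ ω, divergence W ⟨u, hdom u.2⟩ ω * divergence W ⟨v, hdom v.2⟩ ω ∂P =
          ∫ ω, ⟪(u : Lp H 2 P) ω, (v : Lp H 2 P) ω⟫ ∂P +
          ∫ ω, traceIn b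
            ((malliavinDerivIn H W u ω).toCLM ∘L (malliavinDerivIn H W v ω).toCLM) ∂P := by
  -- Closability is what makes the values of the partial map lie in the closed relation that defines
  -- it.
  have hgraph : ∀ F : (malliavinDeriv W).domain,
      ((F : Lp ℝ 2 P), malliavinDeriv W F) ∈ (polynomialGraph W).topologicalClosure := fun F =>
    Submodule.mem_graph_toLinearPMap (hGauss.malliavinDeriv_closable W hgen) F
  have hgraphIn : ∀ u : (malliavinDerivIn H W).domain,
      ((u : Lp H 2 P), malliavinDerivIn H W u) ∈ (polynomialGraphIn H W).topologicalClosure :=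
    fun u => Submodule.mem_graph_toLinearPMap (hGauss.malliavinDerivIn_closable W hgen) u
  -- The candidate for `δ(u)` is the limit of elementary divergences. Any choice will do, since
  -- duality with the densely defined `D` determines it.
  choose ξ hξ using fun u => hGauss.exists_mem_closure_elementaryTriples W (hgraphIn u)
  have hadj : ∀ (u : (malliavinDerivIn H W).domain) (F : (malliavinDeriv W).domain),
      ⟪ξ u, (F : Lp ℝ 2 P)⟫ = ⟪(u : Lp H 2 P), malliavinDeriv W F⟫ := fun u F =>
    hGauss.inner_eq_of_mem_closure W (hξ u) (hgraph F)
  have hdom : (malliavinDerivIn H W).domain ≤ (divergence W).domain := fun u hu =>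
    LinearPMap.mem_adjoint_domain_of_exists u ⟨ξ ⟨u, hu⟩, hadj ⟨u, hu⟩⟩
  have hdiv : ∀ u : (malliavinDerivIn H W).domain, divergence W ⟨u, hdom u.2⟩ = ξ u := fun u =>
    LinearPMap.adjoint_apply_eq (hGauss.dense_malliavinDeriv_domain W hgen) _ (hadj u)
  -- The trace series converges for every `ω`, because the values are Hilbert-Schmidt operators
  -- everywhere.
  refine ⟨hdom, fun u v => ⟨Filter.Eventually.of_forall fun ω =>
    HilbertSchmidt.summable_inner_comp b _ _, ?_, ?_⟩⟩
  · exact memLp_one_iff_integrable.1 ((HilbertSchmidt.traceComp b).memLp_of_bilin 1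
      (Lp.memLp (malliavinDerivIn H W u)) (Lp.memLp (malliavinDerivIn H W v)))
  · have key := hGauss.inner_eq_inner_add_trace W b (hξ u) (hξ v)
    rw [ContinuousLinearMap.lpPairing_eq_integral, L2.inner_def, L2.inner_def] at key
    rw [hdiv, hdiv]
    refine Eq.trans (integral_congr_ae (Filter.Eventually.of_forall fun ω => ?_)) key
    simp [mul_comm]
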